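/- Let $N$ be a lattice of rank $d$ in a $d$-dimensional real vector space $N_{\mathbb R}$. For a $d$-dimensional lattice polytope $P$ (the convex hull of finitely many points of $N$), its $\delta$-vector $\delta_P=(\delta_0,\dots,\delta_d)$ is defined by $$\sum_{k\ge 0}\#(kP\cap N)\,t^k=\frac{\delta_0+\delta_1t+\cdots+\delta_dt^d}{(1-t)^{d+1}},$$ and $\ell$ denotes the largest $i$ with $\delta_i\neq 0$. The polytope $P$ is reflexive if $0$ lies in its interior and the vertices of its polar polytope $\{u\in N_{\mathbb R}^*: u(v)\ge -1\text{ for all }v\in P\}$ lie in the dual lattice $\{u : u(N)\subseteq\mathbb Z\}$. Hibi's unimodality conjecture asserts that if $\delta_i=\delta_{\ell-i}$ for all $0\le i\le \ell$ (in particular if $P$ is reflexive), then $\delta_0\le\delta_1\le\cdots\le\delta_{\lfloor \ell/2\rfloor}$. Let $m$ be a positive integer, let $e_1,\dots,e_{2m}$ be the standard basis of $\mathbb R^{2m}$, let $f=(\frac1m,\dots,\frac1m)\in\mathbb R^{2m}$, let $N=\mathbb Z^{2m}+\mathbb Z f$, and let $P\subset\mathbb R^{2m}$ be the convex hull of $e_1,\dots,e_{2m},e_1-f,\dots,e_{2m}-f$.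 Then $N$ is a lattice of rank $2m$, these points are exactly the vertices of $P$, the polytope $P$ is reflexive with respect to $N$, and $$\delta_P=(1,2m,2m+2,2m,2m+2,\dots,2m+2,2m,1),$$ that is, $\delta_0=\delta_{2m}=1$, $\delta_i=2m$ for odd $i$ with $0<i<2m$, and $\delta_i=2m+2$ for even $i$ with $0<i<2m$. Consequently $\delta_i=\delta_{2m-i}$ for all $0\le i\le 2m$, and the sequence $(\delta_0,\dots,\delta_m)$ has exactly $\lfloor\frac{m-1}{2}\rfloor$ descents (indices $0\le i<m$ with $\delta_i>\delta_{i+1}$). The inequalities $\delta_0\le\cdots\le\delta_m$ hold if and only if $m\le 2$; hence for every $m\ge3$ the polytope $P$ is a counterexample to Hibi's unimodality conjecture, both for lattice polytopes with symmetric $\delta$-vector and for reflexive polytopes, in dimension $2m$. The first counterexample in this family is the case $m=3$, of dimension $6$, with $\delta_P=(1,6,8,6,8,6,1)$. -/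

import Mathlib

open scoped Pointwise

noncomputable section

section General

variable {V : Type*} [NormedAddCommGroup V] [NormedSpace ℝ V]

/-- `P` is a full-dimensional lattice polytope with respect to `L`: the convex hull of finitely many
points of `L`, with non-empty interior. -/
def IsLatticePolytope (L : Submodule ℤ V) (P : Set V) : Prop :=
  (∃ S : Finset V, (S : Set V) ⊆ (L : Set V) ∧ P = convexHull ℝ (S : Set V)) ∧
    (interior P).Nonempty

/-- The dual lattice: the linear functionals that take integer values on `L`. -/
def latticeDual (L : Submodule ℤ V) : Set (Module.Dual ℝ V) :=
  {u | ∀ v ∈ L, ∃ n : ℤ, u v = n}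

/-- The polar of `P`: the linear functionals `u` with `u ≥ -1` on `P`. -/
def polarDual (P : Set V) : Set (Module.Dual ℝ V) :=
  {u | ∀ v ∈ P, -1 ≤ u v}

/-- A lattice polytope is reflexive if it contains `0` in its interior and the vertices of its
polar polytope belong to the dual lattice. -/
def IsReflexivePolytope (L : Submodule ℤ V) (P : Set V) : Prop :=
  IsLatticePolytope L P ∧ (0 : V) ∈ interior P ∧
    (polarDual P).extremePoints ℝ ⊆ latticeDual L

/-- The number `f_P(k)` of lattice points in the dilate `k P`. -/
def ehrhartCount (L : Submodule ℤ V) (P : Set V) (k : ℕ) : ℕ :=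
  ((L : Set V) ∩ ((k : ℝ) • P)).ncard

/-- The generating function `F_P(t) = ∑ f_P(k) t ^ k`. -/
def ehrhartGenFun (L : Submodule ℤ V) (P : Set V) : PowerSeries ℤ :=
  PowerSeries.mk fun k => (ehrhartCount L P k : ℤ)

/-- The entry `δ_i` of the `δ`-vector of `P`: the coefficient of `t ^ i` in
`(1 - t) ^ (d + 1) * F_P(t)`, where `d` is the dimension of the ambient space. -/
def deltaEntry (L : Submodule ℤ V) (P : Set V) (i : ℕ) : ℤ :=
  PowerSeries.coeff i
    ((1 - PowerSeries.X) ^ (Module.finrank ℝ V + 1) * ehrhartGenFun L P)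

/-- The largest index `ℓ` with `δ_ℓ ≠ 0`. -/
def deltaDegree (L : Submodule ℤ V) (P : Set V) : ℕ :=
  sSup {i | deltaEntry L P i ≠ 0}

/-- `δ_i = δ_{ℓ - i}` for all `0 ≤ i ≤ ℓ`. -/
def DeltaSymmetric (L : Submodule ℤ V) (P : Set V) : Prop :=
  ∀ i ≤ deltaDegree L P, deltaEntry L P i = deltaEntry L P (deltaDegree L P - i)

/-- `δ_0 ≤ δ_1 ≤ ⋯ ≤ δ_{⌊ℓ/2⌋}`. -/
def DeltaUnimodal (L : Submodule ℤ V) (P : Set V) : Prop :=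
  MonotoneOn (deltaEntry L P) (Set.Iic (deltaDegree L P / 2))

end General

/-- Hibi's unimodality conjecture in dimension `d`: every `d`-dimensional lattice polytope with
symmetric `δ`-vector has a unimodal `δ`-vector. -/
def HibiConjecture (d : ℕ) : Prop :=
  ∀ (L : Submodule ℤ (Fin d → ℝ)) [DiscreteTopology L] [IsZLattice ℝ L] (P : Set (Fin d → ℝ)),
    IsLatticePolytope L P → DeltaSymmetric L P → DeltaUnimodal L P

/-- Hibi's unimodality conjecture for reflexive polytopes of dimension `d`. -/
def HibiReflexiveConjecture (d : ℕ) : Prop :=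
  ∀ (L : Submodule ℤ (Fin d → ℝ)) [DiscreteTopology L] [IsZLattice ℝ L] (P : Set (Fin d → ℝ)),
    IsReflexivePolytope L P → DeltaUnimodal L P

/-- The number of descents of the finite sequence `(a_0, …, a_n)`. -/
def numDescents (a : ℕ → ℤ) (n : ℕ) : ℕ :=
  ((Finset.range n).filter fun i => a (i + 1) < a i).card

/-- The vector `f = (1/m, …, 1/m)` in `ℝ^{2m}`. -/
def fVec (m : ℕ) : Fin (2 * m) → ℝ := fun _ => 1 / (m : ℝ)

/-- The lattice `N = ℤ^{2m} + ℤ f`. -/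
def exampleLattice (m : ℕ) : Submodule ℤ (Fin (2 * m) → ℝ) :=
  Submodule.span ℤ (Set.range fun j : Fin (2 * m) => (Pi.single j 1 : Fin (2 * m) → ℝ)) ⊔
    Submodule.span ℤ {fVec m}

/-- The points `e_1, …, e_{2m}, e_1 - f, …, e_{2m} - f`. -/
def exampleVertices (m : ℕ) : Set (Fin (2 * m) → ℝ) :=
  (Set.range fun j : Fin (2 * m) => (Pi.single j 1 : Fin (2 * m) → ℝ)) ∪
    Set.range fun j : Fin (2 * m) => (Pi.single j 1 : Fin (2 * m) → ℝ) - fVec m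

/-- The polytope `P`. -/
def examplePolytope (m : ℕ) : Set (Fin (2 * m) → ℝ) :=
  convexHull ℝ (exampleVertices m)

end

/-! ### Facet description, dilates and vertices of the polytope. -/

section Geometry

variable {m : ℕ}

/-! `P` is a prism, the simplex on the `e_j` plus the segment `[-f, 0]`. It has `2m + 2` facets: `|∑
x_i| ≤ 1` and `2m x_j - ∑ x_i ≥ -1` (`examplePolytope_eq`). The facet normals are integral on `N`
and their hull is the polar (`polarDual_examplePolytope`), which gives reflexivity.

Since `m f = ∑ e_j`, each lattice point of `kP` is uniquely `w + p f` with `w ≥ 0`, `∑ w_i = k - r`,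
`0 ≤ r < 2m` and `r - 2k ≤ 2p ≤ r` (`mem_exampleLattice_inter_facetRegion_iff`,
`injOn_pointParams`). For fixed `r` there are `C(2m - 1 + k - r, 2m - 1)` choices of `w` and `k + 1
- (r mod 2)` of `p`. Multiplying the generating function by `(1 - t)^(2m + 1)` leaves `∑_r t^r (a_r
(1 - t) + 2m t)` with `a_r = r + 1 - (r mod 2)`, that is `1, 1, 3, 3, 5, 5, …`. Hence `δ_i = 2m +
a_i - a_{i-1}` for `0 < i < 2m`, and the parity of `r` causes the oscillation. -/

theorem sum_fVec (hm : 0 < m) : ∑ i, fVec m i = 2 := by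
  have : (m : ℝ) ≠ 0 := by positivity
  simp only [fVec, Finset.sum_const, Finset.card_univ, Fintype.card_fin, nsmul_eq_mul]
  push_cast
  field_simp

/-- The facet inequalities of the dilate `k P` of the example polytope. -/
def facetRegion (m : ℕ) (k : ℝ) : Set (Fin (2 * m) → ℝ) :=
  {x | -k ≤ ∑ i, x i ∧ ∑ i, x i ≤ k ∧ ∀ j, -k ≤ 2 * m * x j - ∑ i, x i}

theorem convex_facetRegion (k : ℝ) : Convex ℝ (facetRegion m k) := by
  rintro x ⟨hx1, hx2, hx3⟩ y ⟨hy1, hy2, hy3⟩ a b ha hb hab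
  have hs : ∑ i, (a • x + b • y) i = a * ∑ i, x i + b * ∑ i, y i := by
    simp [Finset.sum_add_distrib, Finset.mul_sum]
  have hk : k = a * k + b * k := by rw [← add_mul, hab, one_mul]
  refine ⟨?_, ?_, fun j => ?_⟩
  · rw [hs]
    linarith [mul_le_mul_of_nonneg_left hx1 ha, mul_le_mul_of_nonneg_left hy1 hb]
  · rw [hs]
    linarith [mul_le_mul_of_nonneg_left hx2 ha, mul_le_mul_of_nonneg_left hy2 hb]
  · rw [hs]
    simp only [Pi.add_apply, Pi.smul_apply, smul_eq_mul]
    linarith [mul_le_mul_of_nonneg_left (hx3 j) ha, mul_le_mul_of_nonneg_left (hy3 j) hb]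

theorem exampleVertices_subset_facetRegion (hm : 0 < m) :
    exampleVertices m ⊆ facetRegion m 1 := by
  have hm' : (m : ℝ) ≠ 0 := by positivity
  rintro _ (⟨j, rfl⟩ | ⟨j, rfl⟩)
  · have hs : ∑ i, (Pi.single j 1 : Fin (2 * m) → ℝ) i = 1 := by simp
    refine ⟨by rw [hs]; norm_num, hs.le, fun i => ?_⟩
    have : (0 : ℝ) ≤ (Pi.single j 1 : Fin (2 * m) → ℝ) i := by
      rw [Pi.single_apply]; split_ifs <;> norm_num
    rw [hs]
    have : 0 ≤ 2 * (m : ℝ) * (Pi.single j 1 : Fin (2 * m) → ℝ) i := by positivity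
    linarith
  · have hs : ∑ i, ((Pi.single j 1 : Fin (2 * m) → ℝ) - fVec m) i = -1 := by
      simp only [Pi.sub_apply, Finset.sum_sub_distrib, sum_fVec hm, Finset.sum_pi_single',
        Finset.mem_univ, if_true]
      norm_num
    refine ⟨hs.ge, by rw [hs]; norm_num, fun i => ?_⟩
    have : (0 : ℝ) ≤ (Pi.single j 1 : Fin (2 * m) → ℝ) i := by
      rw [Pi.single_apply]; split_ifs <;> norm_num
    rw [hs]
    have h2 : 0 ≤ 2 * (m : ℝ) * (Pi.single j 1 : Fin (2 * m) → ℝ) i := by positivity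
    have h3 : 2 * (m : ℝ) * fVec m i = 2 := by simp only [fVec]; field_simp
    simp only [Pi.sub_apply, mul_sub, h3]
    linarith

theorem examplePolytope_eq (hm : 0 < m) : examplePolytope m = facetRegion m 1 := by
  have hm' : (m : ℝ) ≠ 0 := by positivity
  refine (convexHull_min (exampleVertices_subset_facetRegion hm)
    (convex_facetRegion 1)).antisymm ?_
  rintro x ⟨h1, h2, h3⟩
  set s := ∑ i, x i with hs
  -- Prism coordinates: `x + ((1 - s) / 2) f` has coordinate sum `1`, so its coordinates are the
  -- barycentric weights, and `s` fixes the position along the segment from `e_j` to `e_j - f`.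
  have hc : ∀ j, 0 ≤ x j + (1 - s) / (2 * m) := fun j => by
    have := h3 j
    have e : x j + (1 - s) / (2 * m) = (2 * m * x j - s + 1) / (2 * m) := by field_simp; ring
    rw [e]
    exact div_nonneg (by linarith) (by positivity)
  have hsum : ∑ j, (x j + (1 - s) / (2 * m)) = 1 := by
    rw [Finset.sum_add_distrib, ← hs]
    simp only [Finset.sum_const, Finset.card_univ, Fintype.card_fin, nsmul_eq_mul]
    push_cast
    field_simp
    ring
  have key : ∑ j, (x j + (1 - s) / (2 * m)) •
      (((1 + s) / 2) • (Pi.single j 1 : Fin (2 * m) → ℝ) +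
        ((1 - s) / 2) • ((Pi.single j 1 : Fin (2 * m) → ℝ) - fVec m)) ∈ examplePolytope m := by
    refine (convex_convexHull ℝ _).sum_mem (fun j _ => hc j) hsum fun j _ => ?_
    have hP : Convex ℝ (examplePolytope m) := convex_convexHull ℝ _
    have h₁ : (Pi.single j 1 : Fin (2 * m) → ℝ) ∈ examplePolytope m :=
      subset_convexHull ℝ _ (Or.inl ⟨j, rfl⟩)
    have h₂ : (Pi.single j 1 : Fin (2 * m) → ℝ) - fVec m ∈ examplePolytope m :=
      subset_convexHull ℝ _ (Or.inr ⟨j, rfl⟩)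
    exact hP h₁ h₂ (by linarith) (by linarith) (by ring)
  have e : ∀ j, (((1 + s) / 2) • (Pi.single j 1 : Fin (2 * m) → ℝ) +
        ((1 - s) / 2) • ((Pi.single j 1 : Fin (2 * m) → ℝ) - fVec m)) =
      (Pi.single j 1 : Fin (2 * m) → ℝ) - ((1 - s) / 2) • fVec m := fun j => by
    module
  simp only [e] at key
  simp only [smul_sub, Finset.sum_sub_distrib, ← Finset.sum_smul, hsum, one_smul] at key
  rw [← examplePolytope]
  convert key using 1
  ext i
  simp [Finset.sum_apply, Pi.single_apply, fVec]
  field_simp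
  ring

theorem smul_examplePolytope_eq (hm : 0 < m) (k : ℕ) :
    (k : ℝ) • examplePolytope m = facetRegion m k := by
  have hm' : (0 : ℝ) < m := by positivity
  rw [examplePolytope_eq hm]
  -- Division by `k` is impossible at `k = 0`; there the inequalities themselves force `x = 0`.
  rcases Nat.eq_zero_or_pos k with rfl | hk
  · have h0 : (0 : Fin (2 * m) → ℝ) ∈ facetRegion m 1 := by simp [facetRegion]
    rw [Nat.cast_zero, Set.zero_smul_set ⟨0, h0⟩]
    ext x
    simp only [Set.mem_zero]
    constructor
    · rintro rfl
      simp [facetRegion]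
    · rintro ⟨h1, h2, h3⟩
      have hs : ∑ i, x i = 0 := by linarith
      have hx : ∀ j, 0 ≤ x j := fun j => by
        have := h3 j
        rw [hs] at this
        have : 0 ≤ 2 * m * x j := by linarith
        exact nonneg_of_mul_nonneg_right this (by positivity)
      ext j
      exact (Finset.sum_eq_zero_iff_of_nonneg fun i _ => hx i).1 hs j (Finset.mem_univ j)
  · have hk' : (0 : ℝ) < k := by exact_mod_cast hk
    ext x
    rw [Set.mem_smul_set_iff_inv_smul_mem₀ hk'.ne']
    have hs : ∑ i, ((k : ℝ)⁻¹ • x) i = (k : ℝ)⁻¹ * ∑ i, x i := by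
      simp [Finset.mul_sum]
    simp only [facetRegion, Set.mem_ofPred_eq, hs]
    simp only [Pi.smul_apply, smul_eq_mul]
    refine and_congr ?_ (and_congr ?_ (forall_congr' fun j => ?_))
    · rw [inv_mul_eq_div, le_div_iff₀ hk']; simp
    · rw [inv_mul_eq_div, div_le_iff₀ hk']; simp
    · have : 2 * (m : ℝ) * ((k : ℝ)⁻¹ * x j) - (k : ℝ)⁻¹ * ∑ i, x i =
        (2 * m * x j - ∑ i, x i) / k := by field_simp
      rw [this, le_div_iff₀ hk']; simp

theorem zero_mem_interior_examplePolytope (hm : 0 < m) :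
    (0 : Fin (2 * m) → ℝ) ∈ interior (examplePolytope m) := by
  rw [examplePolytope_eq hm, mem_interior_iff_mem_nhds]
  have h1 : ∀ᶠ x : Fin (2 * m) → ℝ in nhds 0, -1 < ∑ i, x i :=
    (continuous_finsetSum _ fun i _ => continuous_apply i).continuousAt.tendsto.eventually_const_lt
      (by simp)
  have h2 : ∀ᶠ x : Fin (2 * m) → ℝ in nhds 0, ∑ i, x i < 1 :=
    (continuous_finsetSum _ fun i _ => continuous_apply i).continuousAt.tendsto.eventually_lt_const
      (by simp)
  have h3 : ∀ j, ∀ᶠ x : Fin (2 * m) → ℝ in nhds 0, -1 < 2 * m * x j - ∑ i, x i := fun j =>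
    (by fun_prop : Continuous fun x : Fin (2 * m) → ℝ =>
      2 * m * x j - ∑ i, x i).continuousAt.tendsto.eventually_const_lt (by simp)
  filter_upwards [h1, h2, Filter.eventually_all.2 h3] with x a b c
  exact ⟨a.le, b.le, fun j => (c j).le⟩

/-- A valid inequality that is tight inside a segment is tight at its ends; this carries tight
facets from a vertex to any segment through it. -/
theorem eq_of_convexCombo_eq_of_le {a b c s t : ℝ} (ha : 0 < a) (hb : 0 < b) (hab : a + b = 1)
    (hs : c ≤ s) (ht : c ≤ t) (h : a * s + b * t = c) : s = c := by
  refine le_antisymm ?_ hs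
  have h' : b * c ≤ b * t := mul_le_mul_of_nonneg_left ht hb.le
  have hc : a * c + b * c = c := by rw [← add_mul, hab, one_mul]
  have : a * s ≤ a * c := by linarith
  exact le_of_mul_le_mul_left this ha

theorem extremePoints_examplePolytope (hm : 0 < m) :
    (examplePolytope m).extremePoints ℝ = exampleVertices m := by
  have hm' : (0 : ℝ) < m := by positivity
  refine extremePoints_convexHull_subset.antisymm fun v hv => ?_
  refine mem_extremePoints_iff_left.2 ⟨subset_convexHull ℝ _ hv, ?_⟩
  rw [← examplePolytope, examplePolytope_eq hm]
  rintro x ⟨hx1, hx2, hx3⟩ y ⟨hy1, hy2, hy3⟩ ⟨a, b, ha, hb, hab, rfl⟩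
  set v := a • x + b • y with hv'
  have hs : ∑ i, v i = a * ∑ i, x i + b * ∑ i, y i := by
    simp [hv', Finset.sum_add_distrib, Finset.mul_sum]
  have hj : ∀ j, 2 * m * v j - ∑ i, v i =
      a * (2 * m * x j - ∑ i, x i) + b * (2 * m * y j - ∑ i, y i) := fun j => by
    rw [hs]; simp only [hv', Pi.add_apply, Pi.smul_apply, smul_eq_mul]; ring
  have hside : ∀ j, 2 * m * v j - ∑ i, v i = -1 → 2 * m * x j - ∑ i, x i = -1 := fun j h =>
    eq_of_convexCombo_eq_of_le ha hb hab (hx3 j) (hy3 j) (by rw [← hj, h])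
  -- At the two vertices indexed by `j`, one bound on the sum and all side inequalities except the
  -- `j`-th are tight; the sum then recovers the `j`-th coordinate.
  have hext : ∀ j, (∀ i, i ≠ j → x i = v i) → ∑ i, x i = ∑ i, v i → x = v := fun j h h' => by
    have : x j = v j := by
      rw [← Finset.add_sum_erase _ _ (Finset.mem_univ j),
        ← Finset.add_sum_erase _ v (Finset.mem_univ j),
        Finset.sum_congr rfl fun i hi => h i (Finset.ne_of_mem_erase hi)] at h'
      linarith
    ext i
    by_cases hi : i = j
    · rw [hi, this]
    · exact h i hi
  rcases hv with ⟨j, hvj⟩ | ⟨j, hvj⟩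
  · have hsv : ∑ i, v i = 1 := by rw [← hvj]; simp
    have hsx : ∑ i, x i = 1 := by
      have := eq_of_convexCombo_eq_of_le ha hb hab (neg_le_neg hx2) (neg_le_neg hy2)
        (by linarith)
      linarith
    refine hext j (fun i hi => ?_) (by rw [hsx, hsv])
    have hvi : v i = 0 := by rw [← hvj]; simp [hi]
    have := hside i
    rw [hvi, hsv, hsx] at this
    have := this (by norm_num)
    rw [hvi]
    have : 2 * m * x i = 0 := by linarith
    simpa [hm'.ne'] using this
  · have hsv : ∑ i, v i = -1 := by
      rw [← hvj]
      simp only [Pi.sub_apply, Finset.sum_sub_distrib, sum_fVec hm, Finset.sum_pi_single',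
        Finset.mem_univ, if_true]
      norm_num
    have hsx : ∑ i, x i = -1 :=
      eq_of_convexCombo_eq_of_le ha hb hab hx1 hy1 (by linarith)
    refine hext j (fun i hi => ?_) (by rw [hsx, hsv])
    have hvi : v i = -(1 / m) := by rw [← hvj]; simp [hi, fVec]
    have := hside i
    rw [hvi, hsv, hsx] at this
    have := this (by field_simp; norm_num)
    rw [hvi]
    field_simp
    linarith

end Geometry

/-! ### Generating functions of the point counts. -/

/-- Absorbs the linear factor `n` into a binomial coefficient, whose generating function is a
shifted inverse power of `1 - t`. -/
theorem choose_mul_identity (d n : ℕ) :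
    n * (d + n).choose d = (d + 1) * (d + n).choose (d + 1) := by
  have := Nat.choose_succ_right_eq (d + n) d
  rw [Nat.add_sub_cancel_left] at this
  linarith

open PowerSeries in
/-- `∑ (n + a) C(d + n, d) tⁿ = (a (1 - t) + (d + 1) t) / (1 - t) ^ (d + 2)`. -/
theorem one_sub_X_pow_mul_mk_linear_mul_choose (d a : ℕ) :
    (1 - X : ℤ⟦X⟧) ^ (d + 2) * mk (fun n => ((n + a) * (d + n).choose d : ℕ) : ℕ → ℤ) =
      (a : ℤ⟦X⟧) * (1 - X) + (d + 1 : ℤ⟦X⟧) * X := by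
  have h : (mk (fun n => ((n + a) * (d + n).choose d : ℕ) : ℕ → ℤ)) =
      (a : ℤ⟦X⟧) * mk (fun n => ((d + n).choose d : ℤ)) +
        (d + 1 : ℤ⟦X⟧) * (X * mk (fun n => ((d + 1 + n).choose (d + 1) : ℤ))) := by
    ext n
    have e1 : (a : ℤ⟦X⟧) = C (a : ℤ) := by simp
    have e2 : (d + 1 : ℤ⟦X⟧) = C (d + 1 : ℤ) := by simp
    rw [e1, e2, map_add, coeff_C_mul, coeff_C_mul, coeff_mk, coeff_mk]
    rcases n with _ | n
    · simp
    · rw [coeff_succ_X_mul, coeff_mk, add_mul, choose_mul_identity]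
      push_cast
      rw [show d + 1 + n = d + (n + 1) by ring]
      ring
  have h1 := mk_add_choose_mul_one_sub_pow_eq_one ℤ d
  have h2 := mk_add_choose_mul_one_sub_pow_eq_one ℤ (d + 1)
  rw [h]
  linear_combination (a : ℤ⟦X⟧) * (1 - X) * h1 + (d + 1 : ℤ⟦X⟧) * X * h2

/-- The number of lattice points in the `k`-th dilate of the example polytope. -/
def pointCount (m k : ℕ) : ℕ :=
  ∑ r ∈ Finset.range (2 * m),
    if r ≤ k then (k + 1 - r % 2) * (2 * m - 1 + (k - r)).choose (2 * m - 1) else 0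

open PowerSeries in
theorem one_sub_X_pow_mul_mk_pointCount {m : ℕ} (hm : 0 < m) :
    (1 - X : ℤ⟦X⟧) ^ (2 * m + 1) * mk (fun k => (pointCount m k : ℤ)) =
      ∑ r ∈ Finset.range (2 * m), X ^ r *
        (((r + 1 - r % 2 : ℕ) : ℤ⟦X⟧) * (1 - X) + (2 * m : ℤ⟦X⟧) * X) := by
  obtain ⟨d, hd⟩ : ∃ d, 2 * m = d + 1 := ⟨2 * m - 1, by omega⟩
  have hd' : (2 * m : ℤ⟦X⟧) = d + 1 := by exact_mod_cast congrArg (Nat.cast (R := ℤ⟦X⟧)) hd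
  have h : mk (fun k => (pointCount m k : ℤ)) = ∑ r ∈ Finset.range (2 * m),
      X ^ r * mk (fun n => ((n + (r + 1 - r % 2)) * (d + n).choose d : ℕ) : ℕ → ℤ) := by
    ext k
    rw [coeff_mk, map_sum, pointCount, Nat.cast_sum]
    refine Finset.sum_congr rfl fun r _ => ?_
    rw [coeff_X_pow_mul']
    split_ifs with hr
    · rw [coeff_mk, hd, Nat.add_sub_cancel,
        show k - r + (r + 1 - r % 2) = k + 1 - r % 2 by omega]
    · rfl
  rw [h, Finset.mul_sum]
  refine Finset.sum_congr rfl fun r _ => ?_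
  rw [hd', ← one_sub_X_pow_mul_mk_linear_mul_choose, hd]
  ring

-- Only the terms `r = i` and `r = i - 1` reach `t^i`. At `i = 2m` only the latter exists and leaves
-- `2m - a_{2m-1} = 1`.
open PowerSeries in
theorem coeff_one_sub_X_pow_mul_mk_pointCount {m : ℕ} (hm : 0 < m) (i : ℕ) :
    coeff i ((1 - X : ℤ⟦X⟧) ^ (2 * m + 1) * mk (fun k => (pointCount m k : ℤ))) =
      if i = 0 ∨ i = 2 * m then 1
        else if 2 * m < i then 0
        else if Odd i then 2 * (m : ℤ)
        else 2 * (m : ℤ) + 2 := by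
  have h : ∀ r : ℕ, X ^ r *
        (((r + 1 - r % 2 : ℕ) : ℤ⟦X⟧) * (1 - X) + (2 * m : ℤ⟦X⟧) * X) =
      C ((r + 1 - r % 2 : ℕ) : ℤ) * X ^ r +
        C (2 * m - (r + 1 - r % 2 : ℕ) : ℤ) * X ^ (r + 1) := fun r => by
    simp only [map_sub, map_mul, map_natCast, map_ofNat]
    ring
  rw [one_sub_X_pow_mul_mk_pointCount hm, Finset.sum_congr rfl fun r _ => h r, map_sum]
  simp only [map_add, coeff_C_mul, coeff_X_pow, mul_ite, mul_one, mul_zero,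
    Finset.sum_add_distrib, Finset.sum_ite_eq, Finset.mem_range]
  rcases i with _ | i
  · simp [hm]
  · simp only [Nat.add_right_cancel_iff, Finset.sum_ite_eq, Finset.mem_range, Nat.odd_iff,
      Nat.add_eq_zero_iff, one_ne_zero, and_false, false_or]
    split_ifs <;> omega

/-! ### The lattice, the polar polytope and reflexivity. -/

section Lattice

variable {m : ℕ}

theorem single_mem_exampleLattice (j : Fin (2 * m)) :
    (Pi.single j 1 : Fin (2 * m) → ℝ) ∈ exampleLattice m :=
  Submodule.mem_sup_left (Submodule.subset_span ⟨j, rfl⟩)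

theorem fVec_mem_exampleLattice : fVec m ∈ exampleLattice m :=
  Submodule.mem_sup_right (Submodule.mem_span_singleton_self _)

theorem exampleVertices_subset_exampleLattice :
    exampleVertices m ⊆ (exampleLattice m : Set (Fin (2 * m) → ℝ)) := by
  rintro _ (⟨j, rfl⟩ | ⟨j, rfl⟩)
  · exact single_mem_exampleLattice j
  · exact sub_mem (single_mem_exampleLattice j) fVec_mem_exampleLattice

theorem mem_exampleLattice_iff {x : Fin (2 * m) → ℝ} :
    x ∈ exampleLattice m ↔ ∃ (z : Fin (2 * m) → ℤ) (p : ℤ), ∀ i, x i = z i + p / m := by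
  constructor
  · intro hx
    obtain ⟨y, hy, w, hw, rfl⟩ := Submodule.mem_sup.1 hx
    obtain ⟨p, rfl⟩ := Submodule.mem_span_singleton.1 hw
    obtain ⟨z, rfl⟩ := (Submodule.mem_span_range_iff_exists_fun ℤ).1 hy
    refine ⟨z, p, fun i => ?_⟩
    simp [Finset.sum_apply, Pi.single_apply, fVec, div_eq_mul_inv]
  · rintro ⟨z, p, h⟩
    have hx : x = ∑ j, z j • (Pi.single j 1 : Fin (2 * m) → ℝ) + p • fVec m := by
      ext i
      rw [h]
      simp [Finset.sum_apply, Pi.single_apply, fVec, div_eq_mul_inv]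
    rw [hx]
    exact add_mem (sum_mem fun j _ => Submodule.smul_mem _ _ (single_mem_exampleLattice j))
      (Submodule.smul_mem _ _ fVec_mem_exampleLattice)

theorem discreteTopology_exampleLattice (hm : 0 < m) : DiscreteTopology (exampleLattice m) := by
  have hm' : (m : ℝ) ≠ 0 := by positivity
  -- Discreteness is inherited from the larger lattice `(1/m) ℤ^{2m}`.
  let b : Module.Basis (Fin (2 * m)) ℝ (Fin (2 * m) → ℝ) :=
    (Pi.basisFun ℝ (Fin (2 * m))).isUnitSMul (w := fun _ => (m : ℝ)⁻¹)
      fun _ => (isUnit_iff_ne_zero.2 hm').inv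
  have hb : (exampleLattice m : Set (Fin (2 * m) → ℝ)) ⊆ Submodule.span ℤ (Set.range b) := by
    intro x hx
    obtain ⟨z, p, h⟩ := mem_exampleLattice_iff.1 hx
    refine (Submodule.mem_span_range_iff_exists_fun ℤ).2 ⟨fun i => m * z i + p, ?_⟩
    ext i
    simp [b, Module.Basis.isUnitSMul_apply, Finset.sum_apply, Pi.single_apply, h]
    field_simp
  exact DiscreteTopology.of_subset
    (inferInstance : DiscreteTopology (Submodule.span ℤ (Set.range b))) hb

theorem span_exampleLattice :
    Submodule.span ℝ (exampleLattice m : Set (Fin (2 * m) → ℝ)) = ⊤ := by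
  rw [eq_top_iff, ← (Pi.basisFun ℝ (Fin (2 * m))).span_eq]
  refine Submodule.span_mono ?_
  rintro _ ⟨j, rfl⟩
  rw [Pi.basisFun_apply]
  exact single_mem_exampleLattice j

theorem isLatticePolytope_examplePolytope (hm : 0 < m) :
    IsLatticePolytope (exampleLattice m) (examplePolytope m) := by
  have hfin : (exampleVertices m).Finite := (Set.finite_range _).union (Set.finite_range _)
  refine ⟨⟨hfin.toFinset, ?_, ?_⟩, ⟨0, zero_mem_interior_examplePolytope hm⟩⟩
  · rw [hfin.coe_toFinset]
    exact exampleVertices_subset_exampleLattice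
  · rw [hfin.coe_toFinset, examplePolytope]

/-- The sum of the coordinates, as a functional. -/
def coordSum (m : ℕ) : Module.Dual ℝ (Fin (2 * m) → ℝ) := ∑ i, LinearMap.proj i

theorem coordSum_apply (x : Fin (2 * m) → ℝ) : coordSum m x = ∑ i, x i := by
  simp [coordSum]

/-- The functionals defining the facets of the example polytope. -/
def facetNormals (m : ℕ) : Set (Module.Dual ℝ (Fin (2 * m) → ℝ)) :=
  {coordSum m, -coordSum m} ∪
    Set.range fun j : Fin (2 * m) => (2 * m : ℝ) • LinearMap.proj j - coordSum m

theorem facetNormals_subset_latticeDual (hm : 0 < m) :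
    facetNormals m ⊆ latticeDual (exampleLattice m) := by
  have hm' : (m : ℝ) ≠ 0 := by positivity
  intro u hu v hv
  obtain ⟨z, p, h⟩ := mem_exampleLattice_iff.1 hv
  have hs : coordSum m v = ((∑ i, z i + 2 * p : ℤ) : ℝ) := by
    rw [coordSum_apply, Finset.sum_congr rfl fun i _ => h i, Finset.sum_add_distrib]
    simp only [Finset.sum_const, Finset.card_univ, Fintype.card_fin, nsmul_eq_mul]
    push_cast
    field_simp
  rcases hu with (rfl | rfl) | ⟨j, rfl⟩
  · exact ⟨_, hs⟩
  · exact ⟨-(∑ i, z i + 2 * p), by rw [LinearMap.neg_apply, hs, Int.cast_neg]⟩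
  · refine ⟨2 * m * z j - ∑ i, z i, ?_⟩
    rw [LinearMap.sub_apply, hs, LinearMap.smul_apply, LinearMap.proj_apply, h]
    push_cast
    simp only [smul_eq_mul]
    field_simp
    ring

theorem facetNormals_subset_polarDual (hm : 0 < m) :
    facetNormals m ⊆ polarDual (examplePolytope m) := by
  intro u hu v hv
  rw [examplePolytope_eq hm] at hv
  obtain ⟨h1, h2, h3⟩ := hv
  rcases hu with (rfl | rfl) | ⟨j, rfl⟩
  · rwa [coordSum_apply]
  · rw [LinearMap.neg_apply, coordSum_apply]
    exact neg_le_neg h2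
  · simpa [coordSum_apply] using h3 j

theorem polarDual_examplePolytope (hm : 0 < m) :
    polarDual (examplePolytope m) = convexHull ℝ (facetNormals m) := by
  have hm' : (0 : ℝ) < m := by positivity
  refine Set.Subset.antisymm ?_ (convexHull_min (facetNormals_subset_polarDual hm) ?_)
  · intro u hu
    set a : Fin (2 * m) → ℝ := fun j => u (Pi.single j 1) with ha
    have hu1 : ∀ j, -1 ≤ a j := fun j => hu _ (subset_convexHull ℝ _ (Or.inl ⟨j, rfl⟩))
    have hu2 : ∀ j, -1 ≤ a j - u (fVec m) := fun j => by
      rw [ha, ← map_sub]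
      exact hu _ (subset_convexHull ℝ _ (Or.inr ⟨j, rfl⟩))
    have hf : ∑ j, a j = m * u (fVec m) := by
      have : (m : ℝ) • fVec m = ∑ j, (Pi.single j 1 : Fin (2 * m) → ℝ) := by
        ext i
        simp [Finset.sum_apply, Pi.single_apply, fVec, hm'.ne']
      have h := congrArg u this
      rw [map_smul, map_sum, smul_eq_mul] at h
      exact h.symm
    set φ := u (fVec m)
    -- One of `± coordSum m` together with the side normals suffices. In the sum over `Option`,
    -- `none` carries the weight `t` of the former.
    have key : ∀ (t : ℝ) (c : Fin (2 * m) → ℝ) (v : Module.Dual ℝ (Fin (2 * m) → ℝ)) (ε : ℝ),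
        v ∈ facetNormals m → v = ε • coordSum m → 0 ≤ t → (∀ j, 0 ≤ c j) → t + ∑ j, c j = 1 →
        (∀ j, a j = ε * t + 2 * m * c j - ∑ i, c i) → u ∈ convexHull ℝ (facetNormals m) := by
      intro t c v ε hv hvε ht hc hsum h
      have hmem : ∑ o : Option (Fin (2 * m)), (o.elim t c) •
          (o.elim v fun j => (2 * m : ℝ) • LinearMap.proj j - coordSum m) ∈
            convexHull ℝ (facetNormals m) := by
        refine (convex_convexHull ℝ _).sum_mem ?_ ?_ ?_
        · rintro (_ | j) -
          exacts [ht, hc j]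
        · simpa [Fintype.sum_option] using hsum
        · rintro (_ | j) -
          exacts [subset_convexHull ℝ _ hv, subset_convexHull ℝ _ (Or.inr ⟨j, rfl⟩)]
      convert hmem using 1
      refine (Pi.basisFun ℝ (Fin (2 * m))).ext fun j => ?_
      rw [Pi.basisFun_apply]
      change a j = _
      rw [h j, hvε]
      simp only [Fintype.sum_option, Option.elim_none, Option.elim_some, LinearMap.add_apply,
        LinearMap.sum_apply, LinearMap.smul_apply, LinearMap.sub_apply, LinearMap.proj_apply,
        coordSum_apply, Finset.mem_univ, if_true, smul_eq_mul, mul_sub,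
        Finset.sum_sub_distrib, mul_one, Pi.single_apply, mul_ite, mul_zero, Finset.sum_ite_eq']
      ring
    -- The side normals vanish on `f` and `coordSum m` takes the value `2` there, so the coefficient
    -- of `coordSum m` must be `φ / 2`; its sign selects the normal.
    rcases le_total 0 φ with hφ | hφ
    · have hs : ∑ j, (a j + 1 - φ) / (2 * m) = 1 - φ / 2 := by
        rw [← Finset.sum_div, Finset.sum_sub_distrib, Finset.sum_add_distrib, hf]
        simp only [Finset.sum_const, Finset.card_univ, Fintype.card_fin, nsmul_eq_mul]
        push_cast
        field_simp
        ring
      refine key (φ / 2) (fun j => (a j + 1 - φ) / (2 * m)) (coordSum m) 1 (Or.inl (Or.inl rfl))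
        (one_smul _ _).symm (by positivity)
        (fun j => div_nonneg (by linarith [hu2 j]) (by positivity)) (by rw [hs]; ring)
        fun j => ?_
      rw [hs]
      field_simp
      ring
    · have hs : ∑ j, (a j + 1) / (2 * m) = 1 + φ / 2 := by
        rw [← Finset.sum_div, Finset.sum_add_distrib, hf]
        simp only [Finset.sum_const, Finset.card_univ, Fintype.card_fin, nsmul_eq_mul]
        push_cast
        field_simp
        ring
      refine key (-φ / 2) (fun j => (a j + 1) / (2 * m)) (-coordSum m) (-1)
        (Or.inl (Or.inr rfl)) (by module) (by linarith)
        (fun j => div_nonneg (by linarith [hu1 j]) (by positivity)) (by rw [hs]; ring)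
        fun j => ?_
      rw [hs]
      field_simp
      ring
  · intro u hu w hw a b ha hb hab v hv
    have h1 := mul_le_mul_of_nonneg_left (hu v hv) ha
    have h2 := mul_le_mul_of_nonneg_left (hw v hv) hb
    simp only [LinearMap.add_apply, LinearMap.smul_apply, smul_eq_mul]
    linarith

theorem isReflexivePolytope_examplePolytope (hm : 0 < m) :
    IsReflexivePolytope (exampleLattice m) (examplePolytope m) := by
  refine ⟨isLatticePolytope_examplePolytope hm, zero_mem_interior_examplePolytope hm, ?_⟩
  rw [polarDual_examplePolytope hm]
  exact extremePoints_convexHull_subset.trans (facetNormals_subset_latticeDual hm)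

end Lattice

/-! ### Counting lattice points and reading off the δ-vector. -/

section Ehrhart

variable {m : ℕ}

/-- Replacing `(z, p)` by `(z + n, p - m n)` keeps the point and moves `∑ z_i` by `2m n`, so `k - ∑
z_i` can be reduced modulo `2m` to a remainder `r`. -/
theorem mem_exampleLattice_inter_facetRegion_iff (hm : 0 < m) (k : ℕ) (x : Fin (2 * m) → ℝ) :
    x ∈ (exampleLattice m : Set (Fin (2 * m) → ℝ)) ∩ facetRegion m k ↔
      ∃ (r : ℕ) (w : Fin (2 * m) → ℕ) (p : ℤ), r < 2 * m ∧ ∑ i, w i + r = k ∧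
        (r : ℤ) - 2 * k ≤ 2 * p ∧ 2 * p ≤ r ∧ ∀ i, x i = w i + p / m := by
  have hm' : (0 : ℝ) < m := by positivity
  have hsum : ∀ (w : Fin (2 * m) → ℤ) (p : ℤ), (∀ i, x i = w i + p / m) →
      ∑ i, x i = ((∑ i, w i + 2 * p : ℤ) : ℝ) := fun w p h => by
    rw [Finset.sum_congr rfl fun i _ => h i, Finset.sum_add_distrib]
    simp only [Finset.sum_const, Finset.card_univ, Fintype.card_fin, nsmul_eq_mul]
    push_cast
    field_simp
  have hside : ∀ (w : Fin (2 * m) → ℤ) (p : ℤ), (∀ i, x i = w i + p / m) → ∀ j,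
      2 * m * x j - ∑ i, x i = ((2 * m * w j - ∑ i, w i : ℤ) : ℝ) := fun w p h j => by
    rw [hsum w p h, h]
    push_cast
    field_simp
    ring
  constructor
  · rintro ⟨hx, h1, h2, h3⟩
    obtain ⟨z, j, hz⟩ := mem_exampleLattice_iff.1 hx
    set S := ∑ i, z i with hS
    have hmz : (0 : ℤ) < 2 * m := by positivity
    have hr0 := Int.emod_nonneg (k - S) hmz.ne'
    have hr1 := Int.emod_lt_of_pos (k - S) hmz
    have hdiv := Int.emod_add_mul_ediv (k - S) (2 * m)
    set r := (k - S) % (2 * m)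
    set n := (k - S) / (2 * m)
    have hw : ∀ i, x i = ((z i + n : ℤ) : ℝ) + ((j - m * n : ℤ) : ℝ) / m := fun i => by
      rw [hz]
      push_cast
      field_simp
      ring
    have hwS : ∑ i, (z i + n) = S + 2 * m * n := by
      rw [Finset.sum_add_distrib, ← hS]
      simp
    -- The side inequality reads `2m w_i ≥ -r > -2m`, so integrality gives `w_i ≥ 0`.
    have hw0 : ∀ i, 0 ≤ z i + n := fun i => by
      have := h3 i
      rw [hside _ _ hw, hwS] at this
      have : -(k : ℤ) ≤ 2 * m * (z i + n) - (S + 2 * m * n) := by exact_mod_cast this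
      by_contra hneg
      have h' : 2 * (m : ℤ) * (z i + n) ≤ 2 * m * (-1) :=
        mul_le_mul_of_nonneg_left (by omega) hmz.le
      linarith
    rw [hsum _ _ hw, hwS] at h1 h2
    have h1' : -(k : ℤ) ≤ S + 2 * m * n + 2 * (j - m * n) := by exact_mod_cast h1
    have h2' : S + 2 * m * n + 2 * (j - m * n) ≤ k := by exact_mod_cast h2
    have hrn : (r.toNat : ℤ) = r := Int.toNat_of_nonneg hr0
    refine ⟨r.toNat, fun i => (z i + n).toNat, j - m * n, by omega, ?_, by linarith,
      by linarith, fun i => ?_⟩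
    · zify
      rw [hrn, Finset.sum_congr rfl fun i _ => Int.toNat_of_nonneg (hw0 i), hwS]
      linarith
    · rw [hw]
      congr 1
      exact_mod_cast congrArg (Int.cast (R := ℝ)) (Int.toNat_of_nonneg (hw0 i)).symm
  · rintro ⟨r, w, p, hr, hwr, h1, h2, hx⟩
    have hx' : ∀ i, x i = ((w i : ℤ) : ℝ) + p / m := fun i => by rw [hx]; simp
    have hwr' : (∑ i, (w i : ℤ)) + r = k := by exact_mod_cast hwr
    refine ⟨mem_exampleLattice_iff.2 ⟨_, p, hx'⟩, ?_, ?_, fun j => ?_⟩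
    · rw [hsum _ _ hx']
      exact_mod_cast (by linarith : -(k : ℤ) ≤ ∑ i, (w i : ℤ) + 2 * p)
    · rw [hsum _ _ hx']
      exact_mod_cast (by linarith : ∑ i, (w i : ℤ) + 2 * p ≤ (k : ℤ))
    · rw [hside _ _ hx']
      have : (0 : ℤ) ≤ 2 * m * w j := by positivity
      exact_mod_cast (by linarith : -(k : ℤ) ≤ 2 * m * w j - ∑ i, (w i : ℤ))

/-- Parameters `(r, w, p)` of the lattice points `w + p f` of the `k`-th dilate. -/
noncomputable def pointParams (m k : ℕ) : Finset (Σ _ : ℕ, (Fin (2 * m) →₀ ℕ) × ℤ) :=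
  ((Finset.range (2 * m)).filter (· ≤ k)).sigma fun r =>
    Finset.finsuppAntidiag Finset.univ (k - r) ×ˢ
      Finset.Icc (-(k : ℤ) + (r + 1) / 2) (r / 2)

theorem mem_pointParams {k r : ℕ} {w : Fin (2 * m) →₀ ℕ} {p : ℤ} :
    (⟨r, w, p⟩ : Σ _ : ℕ, (Fin (2 * m) →₀ ℕ) × ℤ) ∈ pointParams m k ↔
      r < 2 * m ∧ ∑ i, w i + r = k ∧ (r : ℤ) - 2 * k ≤ 2 * p ∧ 2 * p ≤ r := by
  simp only [pointParams, Finset.mem_sigma, Finset.mem_filter, Finset.mem_range,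
    Finset.mem_product, Finset.mem_finsuppAntidiag, Finset.subset_univ, and_true,
    Finset.mem_Icc]
  constructor
  · rintro ⟨⟨h1, h2⟩, h3, h4, h5⟩
    have h3' : ∑ i, w i = k - r := h3
    exact ⟨h1, by omega, by omega, by omega⟩
  · rintro ⟨h1, h2, h3, h4⟩
    have h2' : ∑ i, w i = k - r := by omega
    exact ⟨⟨h1, by omega⟩, h2', by omega, by omega⟩

/-- Stars and bars counts `w`; the range for `p` runs from `-k + ⌈r/2⌉` to `⌊r/2⌋`, whence the
parity correction. -/
theorem card_pointParams (hm : 0 < m) (k : ℕ) : (pointParams m k).card = pointCount m k := by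
  rw [pointParams, Finset.card_sigma, Finset.sum_filter, pointCount]
  refine Finset.sum_congr rfl fun r _ => ?_
  split_ifs with hr
  · rw [Finset.card_product, Finset.card_finsuppAntidiag_nat_eq_choose, Int.card_Icc,
      Finset.card_univ, Fintype.card_fin, mul_comm]
    congr 1
    · omega
    · rw [show 2 * m + (k - r) - 1 = 2 * m - 1 + (k - r) by omega]
      exact Nat.choose_symm_add.symm
  · rfl

theorem injOn_pointParams (hm : 0 < m) (k : ℕ) :
    Set.InjOn (fun (t : Σ _ : ℕ, (Fin (2 * m) →₀ ℕ) × ℤ) (i : Fin (2 * m)) =>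
      (t.2.1 i : ℝ) + (t.2.2 : ℝ) / m) (pointParams m k) := by
  have hm' : (m : ℝ) ≠ 0 := by positivity
  rintro ⟨r, w, p⟩ h ⟨r', w', p'⟩ h' heq
  obtain ⟨h1, h2, -, -⟩ := mem_pointParams.1 (Finset.mem_coe.1 h)
  obtain ⟨h1', h2', -, -⟩ := mem_pointParams.1 (Finset.mem_coe.1 h')
  have hi : ∀ i, (m : ℤ) * w i + p = m * w' i + p' := fun i => by
    have := congrFun heq i
    simp only at this
    field_simp at this
    have h : ((m * w i + p : ℤ) : ℝ) = (m * w' i + p' : ℤ) := by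
      push_cast
      linarith
    exact_mod_cast h
  have h2z : ∑ i, (w i : ℤ) + r = k := by exact_mod_cast h2
  have h2z' : ∑ i, (w' i : ℤ) + r' = k := by exact_mod_cast h2'
  have hsum : (m : ℤ) * ∑ i, (w i : ℤ) + 2 * m * p = m * ∑ i, (w' i : ℤ) + 2 * m * p' := by
    have := Finset.sum_congr (rfl : (Finset.univ : Finset (Fin (2 * m))) = _) fun i _ => hi i
    simpa [Finset.sum_add_distrib, ← Finset.mul_sum] using this
  have hmz : (0 : ℤ) < m := by exact_mod_cast hm
  have hrp : (r' : ℤ) - r = 2 * (p' - p) := by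
    have : (m : ℤ) * (r' - r) = m * (2 * (p' - p)) := by
      linear_combination hsum - m * h2z + m * h2z'
    exact mul_left_cancel₀ hmz.ne' this
  -- Any single coordinate gives this divisibility, while `|r' - r| < 2m` gives `|p' - p| < m`; so
  -- `p' = p`.
  have hdvd : (m : ℤ) ∣ p' - p := by
    let i : Fin (2 * m) := ⟨0, by omega⟩
    exact ⟨w i - w' i, by linear_combination - hi i⟩
  have hp : p' = p := by
    have := Int.eq_zero_of_abs_lt_dvd hdvd (by rw [abs_lt]; constructor <;> omega)
    omega
  have hr : r' = r := by omega
  subst hp hr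
  have hw : w = w' := by
    ext i
    have := hi i
    have : (m : ℤ) * w i = m * w' i := by linarith
    exact_mod_cast mul_left_cancel₀ hmz.ne' this
  rw [hw]

theorem ehrhartCount_examplePolytope (hm : 0 < m) (k : ℕ) :
    ehrhartCount (exampleLattice m) (examplePolytope m) k = pointCount m k := by
  rw [ehrhartCount, smul_examplePolytope_eq hm, ← card_pointParams hm, ← Set.ncard_coe_finset,
    ← (injOn_pointParams hm k).ncard_image]
  congr 1
  ext x
  rw [mem_exampleLattice_inter_facetRegion_iff hm]
  constructor
  · rintro ⟨r, w, p, h1, h2, h3, h4, h⟩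
    refine ⟨⟨r, Finsupp.equivFunOnFinite.symm w, p⟩,
      Finset.mem_coe.2 (mem_pointParams.2 ⟨h1, h2, h3, h4⟩), ?_⟩
    ext i
    exact (h i).symm
  · rintro ⟨⟨r, w, p⟩, h, rfl⟩
    obtain ⟨h1, h2, h3, h4⟩ := mem_pointParams.1 (Finset.mem_coe.1 h)
    exact ⟨r, w, p, h1, h2, h3, h4, fun _ => rfl⟩

theorem deltaEntry_examplePolytope (hm : 0 < m) (i : ℕ) :
    deltaEntry (exampleLattice m) (examplePolytope m) i =
      if i = 0 ∨ i = 2 * m then 1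
        else if 2 * m < i then 0
        else if Odd i then 2 * (m : ℤ)
        else 2 * (m : ℤ) + 2 := by
  rw [← coeff_one_sub_X_pow_mul_mk_pointCount hm, deltaEntry, ehrhartGenFun,
    Module.finrank_fin_fun]
  simp only [ehrhartCount_examplePolytope hm]

theorem deltaDegree_examplePolytope (hm : 0 < m) :
    deltaDegree (exampleLattice m) (examplePolytope m) = 2 * m := by
  refine IsGreatest.csSup_eq ⟨?_, fun i hi => ?_⟩
  · change deltaEntry _ _ _ ≠ 0
    rw [deltaEntry_examplePolytope hm]
    simp
  · by_contra h
    refine hi ?_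
    rw [deltaEntry_examplePolytope hm, if_neg (by omega), if_pos (by omega)]

theorem deltaSymmetric_examplePolytope (hm : 0 < m) :
    DeltaSymmetric (exampleLattice m) (examplePolytope m) := by
  intro i hi
  rw [deltaDegree_examplePolytope hm] at hi ⊢
  rw [deltaEntry_examplePolytope hm, deltaEntry_examplePolytope hm]
  simp only [Nat.odd_iff]
  split_ifs <;> omega

theorem deltaUnimodal_examplePolytope_iff (hm : 0 < m) :
    DeltaUnimodal (exampleLattice m) (examplePolytope m) ↔ m < 3 := by
  rw [DeltaUnimodal, deltaDegree_examplePolytope hm, Nat.mul_div_cancel_left m two_pos]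
  constructor
  · intro h
    by_contra hm3
    -- The first descent is `δ_2 = 2m + 2 > 2m = δ_3`, within the first half exactly when `m ≥ 3`.
    have := h (a := 2) (b := 3) (Set.mem_Iic.2 (by omega)) (Set.mem_Iic.2 (by omega))
      (by norm_num)
    rw [deltaEntry_examplePolytope hm, deltaEntry_examplePolytope hm, if_neg (by omega),
      if_neg (by omega), if_neg (by decide), if_neg (by omega), if_neg (by omega),
      if_pos (by decide)] at this
    linarith
  · intro h i hi j hj hij
    rw [Set.mem_Iic] at hi hj
    rw [deltaEntry_examplePolytope hm, deltaEntry_examplePolytope hm]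
    simp only [Nat.odd_iff]
    split_ifs <;> omega

theorem numDescents_examplePolytope (hm : 0 < m) :
    numDescents (deltaEntry (exampleLattice m) (examplePolytope m)) m = (m - 1) / 2 := by
  have h : ((Finset.range m).filter fun i =>
      deltaEntry (exampleLattice m) (examplePolytope m) (i + 1) <
        deltaEntry (exampleLattice m) (examplePolytope m) i) =
      -- Descents occur exactly at the positive even indices below `m`.
      (Finset.range ((m - 1) / 2)).image fun j => 2 * j + 2 := by
    ext i
    rw [Finset.mem_filter, Finset.mem_range, Finset.mem_image,
      deltaEntry_examplePolytope hm, deltaEntry_examplePolytope hm]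
    simp only [Nat.odd_iff, Finset.mem_range, Nat.add_eq_zero_iff, one_ne_zero,
      and_false, false_or]
    constructor
    · rintro ⟨hi, hlt⟩
      refine ⟨i / 2 - 1, ?_⟩
      split_ifs at hlt <;> omega
    · rintro ⟨j, hj, rfl⟩
      refine ⟨by omega, ?_⟩
      rw [if_neg (by omega), if_neg (by omega), if_pos (by omega), if_neg (by omega),
        if_neg (by omega), if_neg (by omega)]
      linarith
  rw [numDescents, h, Finset.card_image_of_injective _ fun a b hab => by simpa using hab,
    Finset.card_range]

end Ehrhart

theorem mainTheorem3 :
    (∀ m : ℕ, 0 < m →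
      (∃ _ : DiscreteTopology (exampleLattice m), IsZLattice ℝ (exampleLattice m)) ∧
      (examplePolytope m).extremePoints ℝ = exampleVertices m ∧
      IsReflexivePolytope (exampleLattice m) (examplePolytope m) ∧
      (∀ i : ℕ, deltaEntry (exampleLattice m) (examplePolytope m) i =
        if i = 0 ∨ i = 2 * m then 1
        else if 2 * m < i then 0
        else if Odd i then 2 * (m : ℤ)
        else 2 * (m : ℤ) + 2) ∧
      numDescents (deltaEntry (exampleLattice m) (examplePolytope m)) m = (m - 1) / 2 ∧
      DeltaSymmetric (exampleLattice m) (examplePolytope m) ∧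
      (DeltaUnimodal (exampleLattice m) (examplePolytope m) ↔ m < 3) ∧
      (3 ≤ m → ¬ HibiConjecture (2 * m) ∧ ¬ HibiReflexiveConjecture (2 * m))) ∧
    (List.range 7).map (deltaEntry (exampleLattice 3) (examplePolytope 3)) =
      [1, 6, 8, 6, 8, 6, 1] := by
  refine ⟨fun m hm => ?_, ?_⟩
  · have hd := discreteTopology_exampleLattice hm
    have hz : IsZLattice ℝ (exampleLattice m) := ⟨span_exampleLattice⟩
    refine ⟨⟨hd, hz⟩, extremePoints_examplePolytope hm, isReflexivePolytope_examplePolytope hm,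
      deltaEntry_examplePolytope hm, numDescents_examplePolytope hm,
      deltaSymmetric_examplePolytope hm, deltaUnimodal_examplePolytope_iff hm,
      fun hm3 => ⟨fun H => ?_, fun H => ?_⟩⟩
    · exact hm3.not_gt <| (deltaUnimodal_examplePolytope_iff hm).1 <|
        H _ _ (isLatticePolytope_examplePolytope hm) (deltaSymmetric_examplePolytope hm)
    · exact hm3.not_gt <| (deltaUnimodal_examplePolytope_iff hm).1 <|
        H _ _ (isReflexivePolytope_examplePolytope hm)
  · rw [funext (deltaEntry_examplePolytope three_pos)]
    decide
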